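/- Let $\mathbb K=\mathbb R$ or $\mathbb C$, let $\Omega$ be a non-empty set and let $\mathcal F(\Omega)$ be a linear subspace of $\mathbb K^{\Omega}$ carrying a locally convex Hausdorff topology $\tau$ such that $(\mathcal F(\Omega),\tau)$ is a complete bornological DF-space. Suppose that there is a locally convex Hausdorff topology $\widetilde\tau$ on $\mathcal F(\Omega)$, finer than or equal to the topology $\tau_{\mathrm p}$ of pointwise convergence on $\Omega$, such that (BBC) every $\tau$-bounded subset of $\mathcal F(\Omega)$ is contained in an absolutely convex, $\tau$-bounded and $\widetilde\tau$-compact set, and (CNC) $\tau$ has a basis of neighbourhoods of $0$ consisting of absolutely convex $\widetilde\tau$-closed sets. Let $U\subset\Omega$ be a set of uniqueness for $\mathcal F(\Omega)$, i.e. every $f\in\mathcal F(\Omega)$ that vanishes on $U$ is $0$. Let $E$ be a complete locally convex Hausdorff space over $\mathbb K$ with topological dual $E'$, and let $G\subset E'$ be a linear subspace that determines boundedness of $E$, i.e. every $\sigma(E,G)$-bounded subset of $E$ is bounded in $E$. Let $f\colon U\to E$ be a map such that for every $e'\in G$ there is $f_{e'}\in\mathcal F(\Omega)$ with $f_{e'}(x)=e'(f(x))$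 for all $x\in U$. Then there is a unique $F\colon\Omega\to E$ such that $e'\circ F\in\mathcal F(\Omega)$ for all $e'\in E'$ (that is, $F\in\mathcal F(\Omega,E)_\sigma$) and $F(x)=f(x)$ for all $x\in U$. Here a locally convex Hausdorff space is called a DF-space if it has a fundamental sequence of bounded sets and every bornivorous set that is the intersection of a sequence of absolutely convex neighbourhoods of $0$ is itself a neighbourhood of $0$. -/

import Mathlib

open scoped ComplexOrder

namespace WeakExt

section TopologiesOnAVectorSpace

/-! Several topologies on the same vector space are compared below, so topologies are explicit
arguments. Convexity of a set over `𝕜 = ℝ` or `ℂ` is Mathlib's `Convex 𝕜`, whose coefficients are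
the nonnegative reals in `𝕜`. Mathlib's order on topologies is opposite to the usual one:
`τ' ≤ τ` says that `τ` is coarser than `τ'`. -/

variable (𝕜 : Type*) [RCLike 𝕜] {X : Type*} [AddCommGroup X] [Module 𝕜 X]

/-- `(X, τ)` is a locally convex Hausdorff space over `𝕜`. -/
structure IsLCHausdorff (τ : TopologicalSpace X) : Prop where
  isTopologicalAddGroup : @IsTopologicalAddGroup X τ _
  continuousSMul : @ContinuousSMul 𝕜 X _ _ τ
  locallyConvexSpace : @LocallyConvexSpace 𝕜 X _ _ _ _ τ
  t2Space : @T2Space X τ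

/-- `B` is a bounded subset of `(X, τ)`. -/
def IsBdd (τ : TopologicalSpace X) (B : Set X) : Prop :=
  @Bornology.IsVonNBounded 𝕜 X _ _ _ τ B

/-- `V` is bornivorous in `(X, τ)`: it absorbs every bounded set. -/
def IsBornivorous (τ : TopologicalSpace X) (V : Set X) : Prop :=
  ∀ B : Set X, IsBdd 𝕜 τ B → Absorbs 𝕜 V B

/-- A locally convex Hausdorff space `(X, τ)` is bornological if every absolutely convex
bornivorous set is a neighbourhood of `0`. -/
def IsBornological (τ : TopologicalSpace X) : Prop :=
  ∀ V : Set X, AbsConvex 𝕜 V → IsBornivorous 𝕜 τ V → V ∈ @nhds X τ 0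

/-- A locally convex Hausdorff space `(X, τ)` is a DF-space if it has a fundamental sequence of
bounded sets, and every bornivorous set which is the intersection of a sequence of absolutely
convex neighbourhoods of `0` is a neighbourhood of `0`. -/
structure IsDFSpace (τ : TopologicalSpace X) : Prop where
  exists_fundamental_sequence : ∃ B : ℕ → Set X,
    (∀ n, IsBdd 𝕜 τ (B n)) ∧ ∀ A : Set X, IsBdd 𝕜 τ A → ∃ n, A ⊆ B n
  iInter_mem_nhds : ∀ V : ℕ → Set X,
    (∀ n, AbsConvex 𝕜 (V n) ∧ V n ∈ @nhds X τ 0) →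
      IsBornivorous 𝕜 τ (⋂ n, V n) → (⋂ n, V n) ∈ @nhds X τ 0

/-- `(X, τ)` is complete, for the translation-invariant uniform structure of the topological
group `(X, τ)` (which is unique, as `X` is commutative). -/
def IsCompleteTVS (τ : TopologicalSpace X) : Prop :=
  ∃ u : UniformSpace X, u.toTopologicalSpace = τ ∧
    @IsUniformAddGroup X u _ ∧ @CompleteSpace X u

/-- `(X, τ)` satisfies (BBC) for `τ'`: every `τ`-bounded set is contained in an absolutely convex
`τ`-bounded `τ'`-compact set. -/
def SatisfiesBBC (τ τ' : TopologicalSpace X) : Prop :=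
  ∀ B : Set X, IsBdd 𝕜 τ B →
    ∃ K : Set X, B ⊆ K ∧ AbsConvex 𝕜 K ∧ IsBdd 𝕜 τ K ∧ @IsCompact X τ' K

/-- `(X, τ)` satisfies (CNC) for `τ'`: `τ` has a basis of neighbourhoods of `0` consisting of
absolutely convex `τ'`-closed sets. -/
def SatisfiesCNC (τ τ' : TopologicalSpace X) : Prop :=
  ∀ V ∈ @nhds X τ 0, ∃ W ∈ @nhds X τ 0, W ⊆ V ∧ AbsConvex 𝕜 W ∧ @IsClosed X τ' W

end TopologiesOnAVectorSpace

section Functions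

variable {𝕜 : Type*} [RCLike 𝕜] {Ω : Type*}

/-- The topology of pointwise convergence on a linear space `F` of functions on `Ω`. -/
abbrev pointwiseTopology (F : Submodule 𝕜 (Ω → 𝕜)) : TopologicalSpace F :=
  TopologicalSpace.induced (fun f : F => (f : Ω → 𝕜)) Pi.topologicalSpace

/-- `U` is a set of uniqueness for `F`. -/
def IsSetOfUniqueness (F : Submodule 𝕜 (Ω → 𝕜)) (U : Set Ω) : Prop :=
  ∀ f ∈ F, (∀ x ∈ U, f x = 0) → f = 0

variable {E : Type*} [AddCommGroup E] [Module 𝕜 E] [TopologicalSpace E]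

/-- The topology `σ(E, G)` on `E` induced by a linear space `G` of continuous functionals. -/
abbrev sigmaTopology (G : Submodule 𝕜 (StrongDual 𝕜 E)) : TopologicalSpace E :=
  TopologicalSpace.induced (fun (x : E) (g : G) => (g : StrongDual 𝕜 E) x) Pi.topologicalSpace

/-- `G ⊆ E'` determines boundedness of `E`: every `σ(E, G)`-bounded subset of `E` is bounded. -/
def DeterminesBoundedness (G : Submodule 𝕜 (StrongDual 𝕜 E)) : Prop :=
  ∀ B : Set E, IsBdd 𝕜 (sigmaTopology G) B → Bornology.IsVonNBounded 𝕜 B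

variable (E) in
/-- The space `F(Ω, E)_σ` of weak `E`-valued `F`-functions. -/
def weakFunctions (F : Submodule 𝕜 (Ω → 𝕜)) : Submodule 𝕜 (Ω → E) where
  carrier := {f | ∀ e : StrongDual 𝕜 E, (fun x => e (f x)) ∈ F}
  zero_mem' e := by
    have h : (fun x : Ω => e ((0 : Ω → E) x)) = 0 := by ext x; simp
    rw [h]; exact F.zero_mem
  add_mem' {f g} hf hg e := by
    have h : (fun x => e ((f + g) x)) = (fun x => e (f x)) + fun x => e (g x) := by ext x; simp
    rw [h]; exact F.add_mem (hf e) (hg e)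
  smul_mem' c f hf e := by
    have h : (fun x => e ((c • f) x)) = c • fun x => e (f x) := by ext x; simp
    rw [h]; exact F.smul_mem c (hf e)

end Functions

end WeakExt

/-!
The proof avoids constructing a predual of `F` and works with the free vector space `Ω →₀ 𝕜`
instead. A formal combination `y` pairs with a function `k` on `Ω` by
`Finsupp.linearCombination 𝕜 k y = ∑ y x * k x`, so that `Finsupp.single x 1` plays the role of the
point evaluation at `x`. A fundamental sequence of bounded sets of `F` yields an increasing
sequence `B n` covering `F`, and by (BBC) each `B n` lies in an absolutely convex, pointwise
compact subset `K n` of `F`. The combinations carry the countably many seminorms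
`y ↦ sup_{k ∈ B n} ‖∑ y x * k x‖`.

* By Hahn–Banach and compactness, a functional dominated by the seminorm of `K n` is the pairing
  with a scalar multiple of an element of `K n` (`exists_mem_eqOn_of_polar_le`); this is the
  bipolar theorem for the pairing above.
* Hence combinations over a set of uniqueness `U` approximate every point evaluation: otherwise a
  functional vanishing on `U` and not at `x` would be represented by an element of `F`
  (`exists_supported_norm_sub_le`).
* The map `T y = ∑ y x • f x` on combinations over `U` sends bounded sets to `σ(E, G)`-bounded,
  hence bounded, sets. As there are countably many seminorms, `T` is continuous
  (`exists_linearCombination_mem_of_norm_le`).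

By continuity of `T` and completeness of `E`, if `y n` approximates the evaluation at `x`, then
`T (y n)` converges; the limit is `g x`. For `e ∈ E'` the functional `e ∘ T` is represented by some
`h ∈ F`, and `e (g x) = lim ∑ y n u * h u = h x`. Uniqueness holds as `E'` separates points.
-/

namespace WeakExt

open Filter Topology Finsupp

/-! ### Bipolars of compact sets of functions -/

section Bipolar

variable {𝕜 : Type*} [RCLike 𝕜]

/-- Over `ℝ` or `ℂ`, convexity with respect to the nonnegative reals inside `𝕜` is real
convexity. -/
theorem convex_real_of_convex {X : Type*} [AddCommGroup X] [Module 𝕜 X] [Module ℝ X]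
    [IsScalarTower ℝ 𝕜 X] {K : Set X} (hK : Convex 𝕜 K) : Convex ℝ K := by
  intro x hx y hy a b ha hb hab
  have h := hK hx hy (a := (a : 𝕜)) (b := (b : 𝕜)) (by exact_mod_cast ha) (by exact_mod_cast hb)
    (by exact_mod_cast hab)
  simpa only [← RCLike.real_smul_eq_coe_smul] using h

/-- On a balanced set, an upper bound for the real part of a linear functional is a bound for its
norm. -/
theorem norm_le_of_forall_re_le {X : Type*} [AddCommGroup X] [Module 𝕜 X] {K : Set X}
    (hK : Balanced 𝕜 K) (φ : X →ₗ[𝕜] 𝕜) {c : ℝ} (hc : ∀ k ∈ K, RCLike.re (φ k) ≤ c)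
    {k : X} (hk : k ∈ K) : ‖φ k‖ ≤ c := by
  obtain ⟨a, ha, hak⟩ := RCLike.exists_norm_eq_mul_self (φ k)
  have h := hc (a • k) (hK.smul_mem ha.le hk)
  rwa [map_smul, smul_eq_mul, ← hak, RCLike.ofReal_re] at h

/-- A function `h` on finitely many points, bounded by `1` on the polar of an absolutely convex
compact set `K` of functions, agrees there with an element of `K`. -/
theorem exists_mem_eqOn_finset_of_polar_le {Ω : Type*} {K : Set (Ω → 𝕜)} (hKc : IsCompact K)
    (hK0 : 0 ∈ K) (hK : AbsConvex 𝕜 K) (s : Finset Ω) (h : Ω → 𝕜)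
    (hh : ∀ y ∈ supported 𝕜 𝕜 (s : Set Ω), (∀ k ∈ K, ‖linearCombination 𝕜 k y‖ ≤ 1) →
      ‖linearCombination 𝕜 h y‖ ≤ 1) :
    ∃ k ∈ K, ∀ x ∈ s, k x = h x := by
  classical
  let R : (Ω → 𝕜) →ₗ[𝕜] (s → 𝕜) := LinearMap.funLeft 𝕜 𝕜 (fun x : s => (x : Ω))
  have hR : ∀ k x, R k x = k x := fun _ _ => rfl
  have hRc : Continuous R := continuous_pi fun x => continuous_apply (x : Ω)
  by_contra hne
  have hnot : R h ∉ R '' K := by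
    rintro ⟨k, hk, hkh⟩
    exact hne ⟨k, hk, fun x hx => by simpa [hR] using congrFun hkh ⟨x, hx⟩⟩
  obtain ⟨φ, u, hφK, hφh⟩ := RCLike.geometric_hahn_banach_closed_point (𝕜 := 𝕜)
    (convex_real_of_convex (hK.2.linear_image R)) (hKc.image hRc).isClosed hnot
  have hu : 0 < u := by simpa using hφK _ ⟨0, hK0, rfl⟩
  have hb : Balanced 𝕜 (R '' K) := by
    rintro a ha _ ⟨_, ⟨k, hk, rfl⟩, rfl⟩
    exact ⟨a • k, hK.1.smul_mem ha hk, by simp⟩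
  -- The separating functional is the pairing with `y`, normalized to lie in the polar of `K`.
  let y : Ω →₀ 𝕜 := ∑ x : s, single (x : Ω) ((u : 𝕜)⁻¹ * φ (Pi.single x 1))
  have hy : ∀ k : Ω → 𝕜, linearCombination 𝕜 k y = (u : 𝕜)⁻¹ * φ (R k) := by
    intro k
    have e : R k = ∑ x : s, k x • (Pi.single x 1 : s → 𝕜) := by
      ext x
      simp [hR, Finset.sum_apply, Pi.single_apply]
    rw [e]
    simp only [y, map_sum, linearCombination_single, map_smul, smul_eq_mul, Finset.mul_sum]
    exact Finset.sum_congr rfl fun x _ => by ring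
  have hnorm : ∀ z : 𝕜, ‖(u : 𝕜)⁻¹ * z‖ = ‖z‖ / u := fun z => by
    rw [norm_mul, norm_inv, RCLike.norm_ofReal, abs_of_pos hu, inv_mul_eq_div]
  have h1 := hh y (Submodule.sum_mem _ fun x _ => single_mem_supported 𝕜 _ x.2) fun k hk => by
    rw [hy, hnorm, div_le_one hu]
    exact norm_le_of_forall_re_le hb φ.toLinearMap (fun a ha => (hφK a ha).le) ⟨k, hk, rfl⟩
  rw [hy, hnorm, div_le_one hu] at h1
  exact absurd ((hφh.trans_le (RCLike.re_le_norm _)).trans_le h1) (lt_irrefl _)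

/-- The bipolar theorem for the pairing of `Ω →₀ 𝕜` with functions on `Ω`: a function `h` bounded
by `1` on the polar of a pointwise compact absolutely convex set `K`, taken among combinations
over `S`, agrees on `S` with an element of `K`. -/
theorem exists_mem_eqOn_of_polar_le {Ω : Type*} {K : Set (Ω → 𝕜)} (hKc : IsCompact K)
    (hK0 : 0 ∈ K) (hK : AbsConvex 𝕜 K) (S : Set Ω) (h : Ω → 𝕜)
    (hh : ∀ y ∈ supported 𝕜 𝕜 S, (∀ k ∈ K, ‖linearCombination 𝕜 k y‖ ≤ 1) →
      ‖linearCombination 𝕜 h y‖ ≤ 1) :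
    ∃ k ∈ K, ∀ x ∈ S, k x = h x := by
  classical
  obtain ⟨k, hk, hkS⟩ := hKc.inter_iInter_nonempty (fun x : S => {k : Ω → 𝕜 | k x = h x})
    (fun x => isClosed_eq (continuous_apply (x : Ω)) continuous_const) fun v => by
      obtain ⟨k, hk, hkv⟩ := exists_mem_eqOn_finset_of_polar_le hKc hK0 hK
        (v.map (Function.Embedding.subtype _)) h fun y hy =>
          hh y (supported_mono (by simp) hy)
      refine ⟨k, hk, Set.mem_iInter₂.2 fun x hx => hkv x ?_⟩
      exact Finset.mem_map_of_mem (Function.Embedding.subtype _) hx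
  exact ⟨k, hk, fun x hx => Set.mem_iInter.1 hkS ⟨x, hx⟩⟩

/-- If no nonzero element of `K` vanishes on `U`, then every point evaluation is approximated,
uniformly on `K`, by combinations of point evaluations on `U`. -/
theorem exists_supported_norm_sub_le {Ω : Type*} {K : Set (Ω → 𝕜)} (hKc : IsCompact K)
    (hK0 : 0 ∈ K) (hK : AbsConvex 𝕜 K) {U : Set Ω}
    (hU : ∀ k ∈ K, (∀ x ∈ U, k x = 0) → k = 0) (x : Ω) {ε : ℝ} (hε : 0 < ε) :
    ∃ y ∈ supported 𝕜 𝕜 U, ∀ k ∈ K, ‖linearCombination 𝕜 k (y - single x 1)‖ ≤ ε := by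
  classical
  by_contra! hne
  have hxU : x ∉ U := fun hx => by
    obtain ⟨k, -, hk⟩ := hne _ (single_mem_supported 𝕜 1 hx)
    simp [hε.not_gt] at hk
  obtain ⟨k, hk, hkS⟩ := exists_mem_eqOn_of_polar_le hKc hK0 hK (insert x U)
    (Pi.single x (ε : 𝕜)) fun y hy hyK => by
      rw [linearCombination_single_index, norm_smul, RCLike.norm_ofReal, abs_of_pos hε]
      rcases eq_or_ne (y x) 0 with h0 | h0
      · simp [h0]
      -- Write `y = -y x • (w - single x 1)` with `w` supported in `U`.
      set w : Ω →₀ 𝕜 := -((y x)⁻¹ • y.erase x) with hw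
      have hwU : w ∈ supported 𝕜 𝕜 U := by
        refine Submodule.neg_mem _ (Submodule.smul_mem _ _ ?_)
        rw [mem_supported] at hy ⊢
        intro z hz
        have hz' : z ∈ y.support.erase x := support_erase (f := y) ▸ hz
        rw [Finset.mem_erase] at hz'
        exact (hy hz'.2).resolve_left hz'.1
      have hyw : y = -(y x) • (w - single x 1) := by
        rw [hw, smul_sub, smul_neg, smul_smul, neg_mul, mul_inv_cancel₀ h0, smul_single,
          smul_eq_mul, mul_one, neg_smul, one_smul, neg_neg, single_neg, sub_neg_eq_add, add_comm]
        exact (single_add_erase x y).symm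
      obtain ⟨k, hk, hkw⟩ := hne w hwU
      have h1 := hyK k hk
      rw [hyw, map_smul, norm_smul, norm_neg] at h1
      exact (mul_le_mul_of_nonneg_left hkw.le (norm_nonneg _)).trans h1
  have hk0 := hU k hk fun z hz => by
    rw [hkS z (Or.inr hz), Pi.single_eq_of_ne (ne_of_mem_of_not_mem hz hxU)]
  have := hkS x (Or.inl rfl)
  rw [hk0, Pi.single_eq_same, Pi.zero_apply] at this
  exact hε.ne (by exact_mod_cast this)

end Bipolar

/-! ### Continuity from boundedness, and separation by the dual -/

section Continuity

variable {𝕜 : Type*} [RCLike 𝕜] {E : Type*} [AddCommGroup E] [Module 𝕜 E]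

/-- Sets on which each functional in `G` is bounded are `σ(E, G)`-bounded. -/
theorem isBdd_sigmaTopology_of_forall [TopologicalSpace E] (G : Submodule 𝕜 (StrongDual 𝕜 E))
    {A : Set E} (hA : ∀ e ∈ G, ∃ c : ℝ, ∀ z ∈ A, ‖e z‖ ≤ c) : IsBdd 𝕜 (sigmaTopology G) A := by
  let J : E →ₗ[𝕜] (G → 𝕜) := LinearMap.pi fun e => (e : StrongDual 𝕜 E).toLinearMap
  have hJ : Bornology.IsVonNBounded 𝕜 (J '' A) := by
    rw [Bornology.isVonNBounded_pi_iff]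
    intro e
    obtain ⟨c, hc⟩ := hA e e.2
    rw [NormedSpace.isVonNBounded_iff, isBounded_iff_forall_norm_le]
    refine ⟨c, ?_⟩
    rintro _ ⟨_, ⟨z, hz, rfl⟩, rfl⟩
    exact hc z hz
  intro V hV
  rw [nhds_induced] at hV
  obtain ⟨W, hW, hWV⟩ := hV
  have hW' : W ∈ 𝓝 (0 : G → 𝕜) := by
    convert hW using 2
    ext e
    simp
  have := hJ hW'
  rw [Absorbs] at this ⊢
  filter_upwards [this, Bornology.eventually_ne_cobounded (0 : 𝕜)] with a ha ha0 z hz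
  obtain ⟨w, hw, hwz⟩ := ha ⟨z, hz, rfl⟩
  refine ⟨a⁻¹ • z, hWV ?_, smul_inv_smul₀ ha0 z⟩
  have hJz : J (a⁻¹ • z) = w := by rw [map_smul, ← hwz]; exact inv_smul_smul₀ ha0 w
  have hJW : J (a⁻¹ • z) ∈ W := hJz.symm ▸ hw
  exact hJW

/-- Continuity at `0` of `y ↦ ∑ y x • f x` on combinations over `U`, for the seminorms given by
an increasing sequence of sets `B n` of functions. The map sends bounded sets to bounded sets
because `G` determines boundedness, and this suffices since there are countably many seminorms. -/
theorem exists_linearCombination_mem_of_norm_le [TopologicalSpace E]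
    {G : Submodule 𝕜 (StrongDual 𝕜 E)} (hG : DeterminesBoundedness G) {Ω : Type*}
    {B : ℕ → Set (Ω → 𝕜)} (hB : Monotone B) {U : Set Ω} {f : Ω → E}
    (hf : ∀ e ∈ G, ∃ n, ∃ k ∈ B n, ∀ x ∈ U, k x = e (f x)) {V : Set E} (hV : V ∈ 𝓝 0) :
    ∃ n : ℕ, ∀ y ∈ supported 𝕜 𝕜 U,
      (∀ k ∈ B n, ‖linearCombination 𝕜 k y‖ ≤ 1 / ((n : ℝ) + 1)) →
        linearCombination 𝕜 f y ∈ V := by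
  by_contra! hne
  choose y hyU hyB hyV using hne
  -- The rescaled combinations are bounded for every seminorm, but their images are not absorbed.
  let z : ℕ → E := fun n => ((n : 𝕜) + 1) • linearCombination 𝕜 f (y n)
  have hbdd : Bornology.IsVonNBounded 𝕜 (Set.range z) := by
    refine hG _ (isBdd_sigmaTopology_of_forall G fun e he => ?_)
    obtain ⟨m, k, hk, hke⟩ := hf e he
    have hval : ∀ n, e (linearCombination 𝕜 f (y n)) = linearCombination 𝕜 k (y n) := fun n => by
      rw [← ContinuousLinearMap.coe_coe, apply_linearCombination, linearCombination_apply,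
        linearCombination_apply]
      refine Finsupp.sum_congr fun x hx => ?_
      rw [hke x ((mem_supported 𝕜 _).1 (hyU n) hx)]
      rfl
    refine ⟨1 + ∑ n ∈ Finset.range m, ‖e (z n)‖, ?_⟩
    rintro _ ⟨n, rfl⟩
    rcases lt_or_ge n m with hn | hn
    · have := Finset.single_le_sum (f := fun n => ‖e (z n)‖) (fun _ _ => norm_nonneg _)
        (Finset.mem_range.2 hn)
      linarith
    · have h1 := hyB n k (hB hn hk)
      have hpos : (0 : ℝ) < n + 1 := by positivity
      have h2 : ‖e (z n)‖ ≤ 1 := by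
        have hc : ‖(n : 𝕜) + 1‖ = n + 1 := by
          rw [← Nat.cast_succ, RCLike.norm_natCast, Nat.cast_succ]
        rw [map_smul, hval, norm_smul, hc]
        rwa [le_div_iff₀' hpos] at h1
      have : 0 ≤ ∑ n ∈ Finset.range m, ‖e (z n)‖ := Finset.sum_nonneg fun _ _ => norm_nonneg _
      linarith
  obtain ⟨r, hr⟩ := (hbdd hV).exists_pos.imp fun _ h => h.2
  obtain ⟨n, hn⟩ := exists_nat_ge r
  have hc : ‖(n : 𝕜) + 1‖ = n + 1 := by
    rw [← Nat.cast_succ, RCLike.norm_natCast, Nat.cast_succ]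
  have hc0 : (n : 𝕜) + 1 ≠ 0 := Nat.cast_add_one_ne_zero n
  obtain ⟨v, hv, hvz⟩ := hr ((n : 𝕜) + 1) (by rw [hc]; linarith) ⟨n, rfl⟩
  exact hyV n (smul_right_injective E hc0 hvz ▸ hv)

/-- The continuous dual of a locally convex Hausdorff space separates points. -/
theorem eq_of_forall_strongDual_eq [TopologicalSpace E] [IsTopologicalAddGroup E]
    [ContinuousSMul 𝕜 E] [LocallyConvexSpace 𝕜 E] [T2Space E] {a b : E}
    (h : ∀ e : StrongDual 𝕜 E, e a = e b) : a = b := by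
  let _ : Module ℝ E := Module.compHom E (algebraMap ℝ 𝕜)
  have _ : IsScalarTower ℝ 𝕜 E := IsScalarTower.of_algebraMap_smul fun _ _ => rfl
  have _ : LocallyConvexSpace ℝ E :=
    (locallyConvexSpace_iff_exists_convex_subset_zero ℝ E).2 fun W hW => by
      obtain ⟨S, hS, hSc, hSW⟩ :=
        (locallyConvexSpace_iff_exists_convex_subset_zero 𝕜 E).1 inferInstance W hW
      exact ⟨S, hS, convex_real_of_convex hSc, hSW⟩
  by_contra hab
  obtain ⟨e, he⟩ := RCLike.geometric_hahn_banach_point_point (𝕜 := 𝕜) hab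
  exact he.ne (by rw [h e])

end Continuity

/-! ### Exhausting the function space by compact sets -/

section Extension

variable {𝕜 : Type*} [RCLike 𝕜] {Ω : Type*} {F : Submodule 𝕜 (Ω → 𝕜)}

/-- A fundamental sequence of bounded sets together with (BBC) exhausts `F` by an increasing
sequence of sets, each contained in an absolutely convex pointwise compact subset of `F`. -/
theorem exists_exhaustion {τ τ' : TopologicalSpace F} (hτ : IsLCHausdorff 𝕜 τ)
    (hDF : IsDFSpace 𝕜 τ) (hle : τ' ≤ pointwiseTopology F) (hBBC : SatisfiesBBC 𝕜 τ τ') :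
    ∃ B K : ℕ → Set (Ω → 𝕜), Monotone B ∧ (∀ h ∈ F, ∃ n, h ∈ B n) ∧ ∀ n, B n ⊆ K n ∧
      K n ⊆ F ∧ 0 ∈ K n ∧ AbsConvex 𝕜 (K n) ∧ IsCompact (K n) := by
  obtain ⟨D, hD, hDabs⟩ := hDF.exists_fundamental_sequence
  have hsing : ∀ h : F, IsBdd 𝕜 τ {h} := fun h => by
    have := hτ.continuousSMul
    exact @Bornology.isVonNBounded_singleton 𝕜 F _ _ _ τ _ h
  let A : ℕ → Set F := fun n => {0} ∪ ⋃ i ∈ Set.Iic n, D i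
  have hA : ∀ n, IsBdd 𝕜 τ (A n) := fun n =>
    @Bornology.IsVonNBounded.union 𝕜 F _ _ _ τ _ _ (hsing 0)
      ((@Bornology.isVonNBounded_biUnion 𝕜 F _ _ _ τ _ _ (Set.finite_Iic n) _).2 fun i _ => hD i)
  choose K hAK hKabs _ hKc using fun n => hBBC (A n) (hA n)
  refine ⟨fun n => F.subtype '' A n, fun n => F.subtype '' K n, fun m n hmn => ?_, fun h hh => ?_,
    fun n => ⟨Set.image_mono (hAK n), ?_, ⟨0, hAK n (Or.inl rfl), rfl⟩, ⟨?_, ?_⟩, ?_⟩⟩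
  · exact Set.image_mono (Set.union_subset_union_right _
      (Set.biUnion_subset_biUnion_left (Set.Iic_subset_Iic.2 hmn)))
  · obtain ⟨n, hn⟩ := hDabs _ (hsing ⟨h, hh⟩)
    exact ⟨n, ⟨h, hh⟩, Or.inr (Set.mem_biUnion (Set.mem_Iic.2 le_rfl) (hn rfl)), rfl⟩
  · rintro _ ⟨k, -, rfl⟩
    exact k.2
  · rintro a ha _ ⟨_, ⟨k, hk, rfl⟩, rfl⟩
    exact ⟨a • k, (hKabs n).1.smul_mem ha hk, rfl⟩
  · exact (hKabs n).2.linear_image F.subtype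
  · exact @IsCompact.image F (Ω → 𝕜) τ' _ _ _ (hKc n) (continuous_iff_le_induced.2 hle)

end Extension

end WeakExt

/-! ### The extension -/

open Filter Topology Finsupp in
theorem mainTheorem2 {𝕜 : Type*} [RCLike 𝕜] {Ω : Type*} [Nonempty Ω]
    (F : Submodule 𝕜 (Ω → 𝕜)) (τ : TopologicalSpace F)
    (hτ : WeakExt.IsLCHausdorff 𝕜 τ) (hcomplete : WeakExt.IsCompleteTVS τ)
    (hborn : WeakExt.IsBornological 𝕜 τ) (hDF : WeakExt.IsDFSpace 𝕜 τ)
    (hBBC_CNC : ∃ τ' : TopologicalSpace F, WeakExt.IsLCHausdorff 𝕜 τ' ∧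
      τ' ≤ WeakExt.pointwiseTopology F ∧
      WeakExt.SatisfiesBBC 𝕜 τ τ' ∧ WeakExt.SatisfiesCNC 𝕜 τ τ')
    (U : Set Ω) (hU : WeakExt.IsSetOfUniqueness F U)
    {E : Type*} [AddCommGroup E] [Module 𝕜 E] [UniformSpace E] [IsUniformAddGroup E]
    [ContinuousSMul 𝕜 E] [LocallyConvexSpace 𝕜 E] [T2Space E] [CompleteSpace E]
    (G : Submodule 𝕜 (StrongDual 𝕜 E)) (hG : WeakExt.DeterminesBoundedness G)
    (f : U → E)
    (hf : ∀ e ∈ G, ∃ fe ∈ F, ∀ x : U, fe x = e (f x)) :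
    ∃! g : Ω → E, g ∈ WeakExt.weakFunctions E F ∧ ∀ x : U, g x = f x := by
  classical
  obtain ⟨τ', -, hle, hBBC, -⟩ := hBBC_CNC
  obtain ⟨B, K, hBmono, hBcov, hBK⟩ := WeakExt.exists_exhaustion hτ hDF hle hBBC
  choose hBK hKF hK0 hKabs hKc using hBK
  let f₀ : Ω → E := fun x => if hx : x ∈ U then f ⟨x, hx⟩ else 0
  have hf₀ : ∀ x : U, f₀ x = f x := fun x => dif_pos x.2
  have hcont : ∀ V ∈ 𝓝 (0 : E), ∃ n : ℕ, ∀ y ∈ supported 𝕜 𝕜 U,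
      (∀ k ∈ B n, ‖linearCombination 𝕜 k y‖ ≤ 1 / ((n : ℝ) + 1)) →
        linearCombination 𝕜 f₀ y ∈ V := fun V hV =>
    WeakExt.exists_linearCombination_mem_of_norm_le hG hBmono (fun e he => by
      obtain ⟨k, hk, hke⟩ := hf e he
      obtain ⟨n, hn⟩ := hBcov k hk
      exact ⟨n, k, hn, fun x hx => by rw [hke ⟨x, hx⟩, ← hf₀]⟩) hV
  -- Every functional composed with `f` extends to an element of `F`.
  have hext : ∀ e : StrongDual 𝕜 E, ∃ h ∈ F, ∀ x ∈ U, h x = e (f₀ x) := by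
    intro e
    obtain ⟨n, hn⟩ := hcont (e ⁻¹' Metric.closedBall 0 1)
      (e.continuous.continuousAt.preimage_mem_nhds
        (by rw [map_zero]; exact Metric.closedBall_mem_nhds 0 one_pos))
    have hpos : (0 : ℝ) < n + 1 := by positivity
    set c : 𝕜 := (((n : ℝ) + 1 : ℝ) : 𝕜)⁻¹ with hc
    have hcn : ‖c‖ = 1 / ((n : ℝ) + 1) := by
      rw [hc, norm_inv, RCLike.norm_ofReal, abs_of_pos hpos, one_div]
    have hc0 : c ≠ 0 := norm_pos_iff.1 (by rw [hcn]; positivity)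
    obtain ⟨k, hk, hkU⟩ := WeakExt.exists_mem_eqOn_of_polar_le (hKc n) (hK0 n) (hKabs n) U
      ((c • e : StrongDual 𝕜 E) ∘ f₀) fun y hy hyK => by
        have h1 := hn (c • y) (Submodule.smul_mem _ c hy) fun k hk => by
          rw [map_smul, norm_smul, hcn]
          exact mul_le_of_le_one_right (by positivity) (hyK k (hBK n hk))
        rw [Set.mem_preimage, mem_closedBall_zero_iff, map_smul, map_smul] at h1
        have h2 := apply_linearCombination 𝕜 (c • e : StrongDual 𝕜 E).toLinearMap f₀ y
        exact (congrArg norm h2).symm.trans_le h1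
    refine ⟨c⁻¹ • k, F.smul_mem _ (hKF n hk), fun x hx => ?_⟩
    rw [Pi.smul_apply, hkU x hx]
    exact inv_smul_smul₀ hc0 _
  choose H hHF hHU using hext
  have hHlc : ∀ e : StrongDual 𝕜 E, ∀ y ∈ supported 𝕜 𝕜 U,
      e (linearCombination 𝕜 f₀ y) = linearCombination 𝕜 (H e) y := fun e y hy => by
    rw [← ContinuousLinearMap.coe_coe, apply_linearCombination, linearCombination_apply,
      linearCombination_apply]
    refine Finsupp.sum_congr fun x hx => ?_
    rw [hHU e x ((mem_supported 𝕜 _).1 hy hx)]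
    rfl
  have hlim : ∀ x, ∃ a : E, ∀ e : StrongDual 𝕜 E, e a = H e x := by
    intro x
    choose y hyU hyK using fun n : ℕ => WeakExt.exists_supported_norm_sub_le (hKc n) (hK0 n)
      (hKabs n) (fun k hk => hU k (hKF n hk)) x (Nat.one_div_pos_of_nat (α := ℝ) (n := n))
    have hyB : ∀ m n, m ≤ n → ∀ k ∈ B m,
        ‖linearCombination 𝕜 k (y n - single x 1)‖ ≤ 1 / ((n : ℝ) + 1) :=
      fun m n hmn k hk => hyK n k (hBK n (hBmono hmn hk))
    have hcauchy : CauchySeq fun n => linearCombination 𝕜 f₀ (y n) := by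
      rw [cauchySeq_iff]
      intro W hW
      rw [uniformity_eq_comap_nhds_zero E] at hW
      obtain ⟨V, hV, hVW⟩ := hW
      obtain ⟨n, hn⟩ := hcont V hV
      -- The tail bound `1 / (2 * n + 2)` makes differences at most `1 / (n + 1)` on `B n`.
      refine ⟨2 * n + 1, fun p hp q hq => hVW ?_⟩
      rw [Set.mem_preimage, ← map_sub]
      refine hn _ (Submodule.sub_mem _ (hyU q) (hyU p)) fun k hk => ?_
      have hhalf : ∀ p : ℕ, 2 * n + 1 ≤ p → 1 / ((p : ℝ) + 1) ≤ 1 / ((n : ℝ) + 1) / 2 := by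
        intro p hp
        have : (2 * n + 1 : ℝ) ≤ p := by exact_mod_cast hp
        rw [div_div]
        exact one_div_le_one_div_of_le (by positivity) (by linarith)
      rw [← sub_sub_sub_cancel_right (y q) (y p) (single x 1), map_sub]
      have h1 := hyB n p (by omega) k hk
      have h2 := hyB n q (by omega) k hk
      linarith [norm_sub_le (linearCombination 𝕜 k (y q - single x 1))
        (linearCombination 𝕜 k (y p - single x 1)), hhalf p hp, hhalf q hq]
    obtain ⟨a, ha⟩ := cauchySeq_tendsto_of_complete hcauchy
    refine ⟨a, fun e => tendsto_nhds_unique ((e.continuous.tendsto a).comp ha) ?_⟩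
    obtain ⟨m, hm⟩ := hBcov (H e) (hHF e)
    rw [tendsto_iff_norm_sub_tendsto_zero]
    refine squeeze_zero' (Eventually.of_forall fun _ => norm_nonneg _) ?_
      (tendsto_one_div_add_atTop_nhds_zero_nat (𝕜 := ℝ))
    filter_upwards [eventually_ge_atTop m] with n hn
    have h1 := hyB m n hn (H e) hm
    rwa [map_sub, linearCombination_single, one_smul, ← hHlc e _ (hyU n)] at h1
  choose g hg using hlim
  refine ⟨g, ⟨fun e => ?_, fun x => ?_⟩, fun g' hg' => ?_⟩
  · have : (fun x => e (g x)) = H e := funext fun x => hg x e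
    rw [this]
    exact hHF e
  · refine WeakExt.eq_of_forall_strongDual_eq (𝕜 := 𝕜) fun e => ?_
    rw [hg, hHU e x x.2, hf₀]
  · funext x
    refine WeakExt.eq_of_forall_strongDual_eq (𝕜 := 𝕜) fun e => ?_
    rw [hg]
    have h0 := hU _ (F.sub_mem (hg'.1 e) (hHF e)) fun z hz => by
      rw [Pi.sub_apply, hHU e z hz, hg'.2 ⟨z, hz⟩, hf₀ ⟨z, hz⟩, sub_self]
    exact sub_eq_zero.1 (congrFun h0 x)
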